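/- Let $\mathbb X=(X_n,n\ge 1)$ be a strictly stationary sequence of real random variables on a probability space $(\Omega,\mathcal F,\mathbb P)$, let $a>0$, and let $(k_n,n\ge 1)$ be a sequence of integers with $1\le k_n\le n$ for all $n\ge 1$ and $k_n/n\to 1$. Let $\mathcal I^{\mathbb X}$ be the sigma-field of all sets $A\subseteq\Omega$ for which there is a Borel set $B\subseteq\mathbb R^{\mathbb N}$ such that $A=\{\omega:(X_i(\omega),X_{i+1}(\omega),\ldots)\in B\}$ for every $i\ge 1$. Let $\gamma_1=\gamma_1(X_1|\mathcal I^{\mathbb X})$ be (any version of) the conditional right endpoint of the support of $X_1$ given $\mathcal I^{\mathbb X}$, that is, an $\mathcal I^{\mathbb X}$-measurable function $\Omega\to[-\infty,\infty]$ such that $\mathbb P(X_1\le\gamma_1|\mathcal I^{\mathbb X})=1$ a.s. and such that $\gamma_1\le Q$ a.s. for every $\mathcal I^{\mathbb X}$-measurable $Q:\Omega\to[-\infty,\infty]$ with $\mathbb P(X_1\le Q|\mathcal I^{\mathbb X})=1$ a.s. Assume that $$\mathbb P(X_1=\gamma_1)=0\quad\text{and}\quad \mathbb P(X_1=\gamma_1-a)=0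 .$$ Let $(N(t),t\ge 0)$ be a family of nonnegative integer-valued random variables on the same space (not assumed independent of $\mathbb X$), and put $$\mathcal K_t(k_{N(t)},a)=\sum_{i=1}^{N(t)} I\big(X_{k_{N(t)}:N(t)}-a<X_i<X_{k_{N(t)}:N(t)}\big),$$ where $X_{k:n}$ is the $k$-th smallest of $X_1,\ldots,X_n$ (and the sum is $0$ when $N(t)=0$). If $N(t)\to\infty$ a.s. as $t\to\infty$, then $$\frac{\mathcal K_t(k_{N(t)},a)}{N(t)}\longrightarrow I(\gamma_1<\infty)\cdot\mathbb P\big(X_1>\gamma_1-a\,\big|\,\mathcal I^{\mathbb X}\big)\quad\text{a.s. as }t\to\infty .$$ If instead $N(t)\to\infty$ in probability as $t\to\infty$, i.e. $\mathbb P(N(t)\le D)\to 0$ for every real $D$, then the same convergence holds in probability. (The quotient is read as $0$ when $N(t)=0$.) -/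

import Mathlib

open MeasureTheory ProbabilityTheory Filter Topology
open scoped NNReal ENNReal

namespace NearMax

/-- A process `(X₁, X₂, …)` is indexed from `0` in Lean, so `X i` stands for `X_{i+1}`.
It is strictly stationary when the law of the whole sequence is invariant under every shift. -/
def StrictlyStationary {Ω : Type*} [MeasurableSpace Ω] (μ : Measure Ω) (X : ℕ → Ω → ℝ) : Prop :=
  ∀ h : ℕ, IdentDistrib (fun ω (j : ℕ) => X (h + j) ω) (fun ω (j : ℕ) => X j ω) μ μ

/-- The sigma-field of sets invariant with respect to the sequence `X`: the sets `A` for which there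
is one Borel set `B` of real sequences with `A = {ω | (X_i(ω), X_{i+1}(ω), …) ∈ B}` for all `i`. -/
@[reducible] def invariantSigma {Ω : Type*} (X : ℕ → Ω → ℝ) : MeasurableSpace Ω where
  MeasurableSet' A := ∃ B : Set (ℕ → ℝ), MeasurableSet B ∧
    ∀ i : ℕ, A = {ω | (fun j : ℕ => X (i + j) ω) ∈ B}
  measurableSet_empty := ⟨∅, MeasurableSet.empty, fun i => by simp⟩
  measurableSet_compl := by
    rintro A ⟨B, hB, hA⟩
    refine ⟨Bᶜ, hB.compl, fun i => ?_⟩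
    conv_lhs => rw [hA i]
    rfl
  measurableSet_iUnion := by
    intro f hf
    choose B hB hA using hf
    refine ⟨⋃ n, B n, MeasurableSet.iUnion hB, fun i => ?_⟩
    ext ω
    simp only [Set.mem_iUnion, Set.mem_ofPred_eq]
    refine exists_congr fun n => ?_
    conv_lhs => rw [hA n i]
    rfl

theorem invariantSigma_le {Ω : Type*} [m0 : MeasurableSpace Ω] {X : ℕ → Ω → ℝ}
    (hX : ∀ i, Measurable (X i)) : invariantSigma X ≤ m0 := by
  rintro A ⟨B, hB, hA⟩
  rw [hA 0]
  exact measurableSet_preimage (measurable_pi_lambda _ fun j => hX (0 + j)) hB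

/-- `γ` is (a version of) the conditional right endpoint of the support of `X` given `G`: the
a.s. smallest `G`-measurable extended random variable `Q` with `P(X ≤ Q | G) = 1` a.s. -/
structure IsCondRightEndpoint {Ω : Type*} [m0 : MeasurableSpace Ω] (μ : Measure Ω)
    (G : MeasurableSpace Ω) (X : Ω → ℝ) (γ : Ω → EReal) : Prop where
  measurable : Measurable[G] γ
  condProb_le : μ⟦{ω | (X ω : EReal) ≤ γ ω}|G⟧ =ᵐ[μ] fun _ => 1
  minimal : ∀ Q : Ω → EReal, Measurable[G] Q →
    μ⟦{ω | (X ω : EReal) ≤ Q ω}|G⟧ =ᵐ[μ] (fun _ => 1) → ∀ᵐ ω ∂μ, γ ω ≤ Q ω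

/-- The conditional right endpoint of the support exists. -/
theorem exists_isCondRightEndpoint {Ω : Type*} {G : MeasurableSpace Ω}
    [m0 : MeasurableSpace Ω] (μ : Measure Ω) [IsProbabilityMeasure μ] (hG : G ≤ m0) {X : Ω → ℝ}
    (hX : Measurable X) : ∃ γ : Ω → EReal, IsCondRightEndpoint μ G X γ := by
  -- on a set of `G`, `X ≤ Q` holds a.s. exactly when the conditional probability is one there
  have key : ∀ s : Set Ω, MeasurableSet s → ∀ A : Set Ω, MeasurableSet[G] A →
      ((∀ᵐ ω ∂μ, ω ∈ A → (μ⟦s|G⟧) ω = 1) ↔ ∀ᵐ ω ∂μ, ω ∈ A → ω ∈ s) := by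
    intro s hs A hA
    have hint : Integrable (s.indicator fun _ => (1 : ℝ)) μ := (integrable_const 1).indicator hs
    have hset := setIntegral_condExp hG hint hA
    have hA' := hG A hA
    constructor
    · intro h
      have h1 : ∫ ω in A, (μ⟦s|G⟧) ω ∂μ = ∫ ω in A, (1 : ℝ) ∂μ :=
        setIntegral_congr_ae hA' h
      rw [h1] at hset
      have h2 : ∫ ω in A, (1 - s.indicator (fun _ => (1 : ℝ)) ω) ∂μ = 0 := by
        rw [integral_sub (integrable_const 1) hint.integrableOn, hset, sub_self]
      rw [setIntegral_eq_zero_iff_of_nonneg_ae] at h2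
      · rw [Filter.EventuallyEq, ae_restrict_iff' hA'] at h2
        filter_upwards [h2] with ω hω hωA
        by_contra hns
        simpa [hns] using hω hωA
      · refine Eventually.of_forall fun ω => ?_
        by_cases hω : ω ∈ s <;> simp [hω]
      · exact ((integrable_const 1).sub hint).integrableOn
    · intro h
      have h1 : (A.indicator (s.indicator fun _ => (1 : ℝ))) =ᵐ[μ] A.indicator fun _ => 1 := by
        filter_upwards [h] with ω hω
        by_cases hA1 : ω ∈ A
        · simp [hA1, hω hA1]
        · simp [hA1]
      have h2 := (condExp_congr_ae (m := G) h1).symm.trans (condExp_indicator hint hA)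
      rw [condExp_of_stronglyMeasurable hG (stronglyMeasurable_const.indicator hA)
        ((integrable_const 1).indicator hA')] at h2
      filter_upwards [h2] with ω hω hωA
      simpa [hωA] using hω.symm
  have hsm : ∀ Q : Ω → EReal, Measurable[G] Q → MeasurableSet {ω | (X ω : EReal) ≤ Q ω} :=
    fun Q hQ => measurableSet_le hX.coe_real_ereal (hQ.mono hG le_rfl)
  have hall : ∀ Q : Ω → EReal, Measurable[G] Q →
      ((μ⟦{ω | (X ω : EReal) ≤ Q ω}|G⟧ =ᵐ[μ] fun _ => 1) ↔ ∀ᵐ ω ∂μ, (X ω : EReal) ≤ Q ω) := by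
    intro Q hQ
    have := key _ (hsm Q hQ) Set.univ MeasurableSet.univ
    simpa [Filter.EventuallyEq] using this
  let p : ℚ → Ω → ℝ := fun q => μ⟦{ω | X ω ≤ q}|G⟧
  have hpm : ∀ q, MeasurableSet[G] {ω | p q ω = 1} := fun q =>
    (stronglyMeasurable_condExp.measurable : Measurable[G] (p q)) (measurableSet_singleton 1)
  have hXq : ∀ q : ℚ, MeasurableSet {ω | X ω ≤ q} := fun q => measurableSet_le hX measurable_const
  classical
  have hmeas : Measurable[G] fun ω => ⨅ q : ℚ, if p q ω = 1 then ((q : ℝ) : EReal) else ⊤ :=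
    Measurable.iInf fun q => Measurable.ite (hpm q) measurable_const measurable_const
  refine ⟨fun ω => ⨅ q : ℚ, if p q ω = 1 then ((q : ℝ) : EReal) else ⊤, hmeas, ?_, ?_⟩
  · rw [hall _ hmeas]
    have h : ∀ q : ℚ, ∀ᵐ ω ∂μ, p q ω = 1 → X ω ≤ q := fun q =>
      (key _ (hXq q) _ (hpm q)).1 (Eventually.of_forall fun ω hω => hω)
    filter_upwards [ae_all_iff.2 h] with ω hω
    refine le_iInf fun q => ?_
    split_ifs with hq
    · exact EReal.coe_le_coe_iff.2 (hω q hq)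
    · exact le_top
  · intro Q hQ hQ1
    rw [hall Q hQ] at hQ1
    have h : ∀ q : ℚ, ∀ᵐ ω ∂μ, Q ω < ((q : ℝ) : EReal) → p q ω = 1 := fun q =>
      (key _ (hXq q) {ω | Q ω < ((q : ℝ) : EReal)} (hQ measurableSet_Iio)).2 (by
        filter_upwards [hQ1] with ω hω hq
        exact EReal.coe_le_coe_iff.1 (hω.trans hq.le))
    filter_upwards [ae_all_iff.2 h] with ω hω
    refine le_of_forall_gt_imp_ge_of_dense fun c hc => ?_
    obtain ⟨q, hq1, hq2⟩ := EReal.lt_iff_exists_rat_btwn.1 hc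
    refine (iInf_le _ q).trans ?_
    rw [if_pos (hω q hq1)]
    exact hq2.le

/-- The order statistic `x_{k:n}`, i.e. the `k`-th smallest of the first `n` terms of `x`, for
`1 ≤ k ≤ n` (and `0`, a value that is never used, for other `k`). -/
noncomputable def orderStat (x : ℕ → ℝ) (k n : ℕ) : ℝ :=
  if h : 1 ≤ k ∧ k ≤ n then
    (fun i : Fin n => x i) (Tuple.sort (fun i : Fin n => x i) ⟨k - 1, by omega⟩)
  else 0

/-- The number `K(k, n, a)` of those among the first `n` terms of `x` that lie in the open interval
`(x_{k:n} - a, x_{k:n})`. -/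
noncomputable def nearCount (x : ℕ → ℝ) (k n : ℕ) (a : ℝ) : ℝ :=
  ∑ i ∈ Finset.range n, (Set.Ioo (orderStat x k n - a) (orderStat x k n)).indicator 1 (x i)

/-- The variable `𝒦_t(k_{N(t)}, a)`, where `N` is the value `N(t)` of the counting process. -/
noncomputable def randomNearCount {Ω : Type*} (X : ℕ → Ω → ℝ) (k : ℕ → ℕ) (N : Ω → ℕ) (a : ℝ)
    (ω : Ω) : ℝ :=
  nearCount (fun i => X i ω) (k (N ω)) (N ω) a

/-- `I(γ < ∞) · P(X > γ - a | G)`. -/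
noncomputable def limitVariable {Ω : Type*} [m0 : MeasurableSpace Ω] (μ : Measure Ω)
    (G : MeasurableSpace Ω) (X : Ω → ℝ) (γ : Ω → EReal) (a : ℝ) (ω : Ω) : ℝ :=
  {ω' | γ ω' < ⊤}.indicator (fun _ => (1 : ℝ)) ω *
    (μ⟦{ω' | γ ω' - (a : EReal) < (X ω' : EReal)}|G⟧) ω

/-- `N(t) → ∞` in probability. -/
def TendstoInftyInProbability {Ω : Type*} [MeasurableSpace Ω] (μ : Measure Ω)
    (N : ℝ≥0 → Ω → ℕ) : Prop :=
  ∀ D : ℝ, Tendsto (fun t => μ {ω | (N t ω : ℝ) ≤ D}) atTop (𝓝 0)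

end NearMax

/-! The argument is pathwise. Let κ be the conditional law of the first term given the invariant
sigma-field (`exists_condLaw`). By Birkhoff's theorem (`ae_tendsto_average`), almost surely the
empirical distribution functions converge at every rational to that of κ. Minimality of γ says that
κ(-∞, q] < 1 for each rational q < γ, so, as k_n/n → 1, the order statistic eventually exceeds every
such q. Since γ is invariant and dominates the first term, it dominates all terms (`ae_forall_le`).

If γ is finite, the order statistic thus tends to γ from below, and the window is squeezed between
intervals with rational endpoints. No mass at γ or γ - a means that the squeeze closes at κ(γ - a,
∞). If γ = ∞, the window moves beyond every level and the proportion tends to 0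
(`tendsto_nearCount_div_of_cdf`).

Random sample sizes need no independence: almost sure limits are composed path by path, and in
probability a late deviation is bounded by the tail event of any deviation after time D
(`tendstoInMeasure_comp_randomIndex`). -/

namespace NearMax

/-! ### Invariance of the upper limit of averages -/

/-- The sequences whose averages of `f` exceed some number larger than `r` infinitely often. -/
def limsupExceeds (f : ℝ → ℝ) (r : ℝ) : Set (ℕ → ℝ) :=
  {x | ∃ s : ℚ, r < s ∧ ∃ᶠ n : ℕ in atTop, (s : ℝ) * n < ∑ i ∈ Finset.range n, f (x i)}

theorem measurableSet_limsupExceeds {f : ℝ → ℝ} (hf : Measurable f) (r : ℝ) :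
    MeasurableSet (limsupExceeds f r) := by
  have : limsupExceeds f r = ⋃ s : ℚ, ⋃ _ : r < s, ⋂ m : ℕ, ⋃ n : ℕ, ⋃ _ : m ≤ n,
      {x | (s : ℝ) * n < ∑ i ∈ Finset.range n, f (x i)} := by
    ext x
    simp only [limsupExceeds, frequently_atTop, Set.mem_ofPred_eq, Set.mem_iUnion, Set.mem_iInter,
      exists_prop]
  rw [this]
  refine MeasurableSet.iUnion fun s => MeasurableSet.iUnion fun _ => MeasurableSet.iInter fun m =>
    MeasurableSet.iUnion fun n => MeasurableSet.iUnion fun _ => ?_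
  exact measurableSet_lt measurable_const
    (Finset.measurable_sum _ fun i _ => hf.comp (measurable_pi_apply i))

/-- A shift changes the sum by one bounded term and the length by one. The room between r and the
rational s absorbs this for large n, which is why the definition asks for some s > r instead of
using r itself. -/
theorem mem_limsupExceeds_shift {f : ℝ → ℝ} {C : ℝ} (hC : ∀ y, |f y| ≤ C) (r : ℝ) (x : ℕ → ℝ) :
    (fun j => x (1 + j)) ∈ limsupExceeds f r ↔ x ∈ limsupExceeds f r := by
  have hsum : ∀ n, ∑ i ∈ Finset.range (n + 1), f (x i) =
      ∑ i ∈ Finset.range n, f (x (1 + i)) + f (x 0) := fun n => by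
    rw [Finset.sum_range_succ']
    simp only [add_comm 1]
  have hb := abs_le.1 (hC (x 0))
  constructor
  · rintro ⟨s, hs, hfr⟩
    obtain ⟨s', h1, h2⟩ := exists_rat_btwn hs
    refine ⟨s', h1, ?_⟩
    -- The slack (s - s')n pays for the extra term, which is at least -C, and for the s' caused by
    -- length n + 1.
    have hlarge : ∀ᶠ n : ℕ in atTop, C + s' < ((s : ℝ) - s') * n :=
      (tendsto_natCast_atTop_atTop.const_mul_atTop (sub_pos.2 h2)).eventually_gt_atTop _
    have := (hfr.and_eventually hlarge).mono (q := fun n =>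
        (s' : ℝ) * ((n + 1 : ℕ) : ℝ) < ∑ i ∈ Finset.range (n + 1), f (x i)) (by
      rintro n ⟨h3, h4⟩
      rw [hsum]
      push_cast
      linarith)
    exact (tendsto_add_atTop_nat 1).frequently this
  · rintro ⟨s, hs, hfr⟩
    obtain ⟨s', h1, h2⟩ := exists_rat_btwn hs
    refine ⟨s', h1, ?_⟩
    have hlarge : ∀ᶠ n : ℕ in atTop, C - s < ((s : ℝ) - s') * n :=
      (tendsto_natCast_atTop_atTop.const_mul_atTop (sub_pos.2 h2)).eventually_gt_atTop _
    have hfr' : ∃ᶠ n : ℕ in atTop,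
        (s : ℝ) * ((n + 1 : ℕ) : ℝ) < ∑ i ∈ Finset.range (n + 1), f (x i) := by
      rw [frequently_atTop] at hfr ⊢
      intro m
      obtain ⟨n, hn, h⟩ := hfr (m + 1)
      refine ⟨n - 1, by omega, ?_⟩
      rwa [Nat.sub_add_cancel (by omega)]
    refine (hfr'.and_eventually hlarge).mono ?_
    rintro n ⟨h3, h4⟩
    rw [hsum] at h3
    push_cast at h3
    linarith

/-- The invariant sigma-field demands the same Borel set for every shift, exactly and not just
almost surely; iterating the one-step invariance gives this. -/
theorem measurableSet_invariantSigma_limsupExceeds {Ω : Type*} {X : ℕ → Ω → ℝ}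
    {f : ℝ → ℝ} (hf : Measurable f) {C : ℝ} (hC : ∀ y, |f y| ≤ C) (r : ℝ) :
    MeasurableSet[invariantSigma X] {ω | (fun j => X j ω) ∈ limsupExceeds f r} := by
  refine ⟨limsupExceeds f r, measurableSet_limsupExceeds hf r, fun i => ?_⟩
  induction i with
  | zero => simp only [zero_add]
  | succ i ih =>
    rw [ih]
    ext ω
    have := mem_limsupExceeds_shift hC r fun j => X (i + j) ω
    simp only [Set.mem_ofPred_eq, add_assoc] at this ⊢
    exact this.symm

/-! ### Maximal inequality and Birkhoff's theorem -/

section Ergodic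

variable {Ω : Type*} [m0 : MeasurableSpace Ω] {μ : Measure Ω} {X : ℕ → Ω → ℝ}

/-- On an invariant event, a functional of a stationary sequence and of the shifted sequence have
the same integral. -/
theorem setIntegral_shift_eq (hX : ∀ i, Measurable (X i)) (hstat : StrictlyStationary μ X)
    {A : Set Ω} (hA : MeasurableSet[invariantSigma X] A) {F : (ℕ → ℝ) → ℝ} (hF : Measurable F)
    (h : ℕ) :
    ∫ ω in A, F (fun j => X (h + j) ω) ∂μ = ∫ ω in A, F (fun j => X j ω) ∂μ := by
  have hA' : MeasurableSet A := invariantSigma_le hX A hA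
  obtain ⟨B, hB, hAB⟩ := hA
  have key : ∀ i, ∫ ω in A, F (fun j => X (i + j) ω) ∂μ =
      ∫ ω, B.indicator F (fun j => X (i + j) ω) ∂μ := by
    intro i
    rw [← integral_indicator hA']
    congr 1
    ext ω
    have : ω ∈ A ↔ (fun j => X (i + j) ω) ∈ B := by
      conv_lhs => rw [hAB i]
      rfl
    by_cases hω : ω ∈ A
    · rw [Set.indicator_of_mem hω, Set.indicator_of_mem (this.1 hω)]
    · rw [Set.indicator_of_notMem hω, Set.indicator_of_notMem (mt this.2 hω)]
  have h0 := key 0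
  simp only [zero_add] at h0
  rw [key h, h0]
  exact ((hstat h).comp (hF.indicator hB)).integral_eq

/-- The maximum over `0 ≤ m ≤ n` of the partial sums `∑ i < m, g (x i)`. -/
noncomputable def maxPartialSum (g : ℝ → ℝ) : ℕ → (ℕ → ℝ) → ℝ
  | 0, _ => 0
  | n + 1, x => max 0 (g (x 0) + maxPartialSum g n fun j => x (1 + j))

theorem maxPartialSum_nonneg (g : ℝ → ℝ) (n : ℕ) (x : ℕ → ℝ) : 0 ≤ maxPartialSum g n x := by
  cases n with
  | zero => exact le_rfl
  | succ n => exact le_max_left _ _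

theorem maxPartialSum_mono (g : ℝ → ℝ) (x : ℕ → ℝ) : Monotone fun n => maxPartialSum g n x := by
  refine monotone_nat_of_le_succ fun n => ?_
  induction n generalizing x with
  | zero => exact maxPartialSum_nonneg _ _ _
  | succ n ih => exact max_le_max le_rfl (add_le_add le_rfl (ih _))

theorem sum_le_maxPartialSum (g : ℝ → ℝ) (n : ℕ) (x : ℕ → ℝ) :
    ∑ i ∈ Finset.range n, g (x i) ≤ maxPartialSum g n x := by
  induction n generalizing x with
  | zero => exact le_rfl
  | succ n ih =>
    rw [Finset.sum_range_succ', add_comm]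
    refine le_max_of_le_right (add_le_add le_rfl ?_)
    simpa only [add_comm 1] using ih fun j => x (1 + j)

theorem maxPartialSum_le {g : ℝ → ℝ} {C : ℝ} (hC0 : 0 ≤ C) (hC : ∀ y, |g y| ≤ C) (n : ℕ)
    (x : ℕ → ℝ) : maxPartialSum g n x ≤ n * C := by
  induction n generalizing x with
  | zero => simp [maxPartialSum]
  | succ n ih =>
    refine max_le (by positivity) ?_
    have := ih fun j => x (1 + j)
    have := (abs_le.1 (hC (x 0))).2
    push_cast
    linarith

theorem measurable_maxPartialSum {g : ℝ → ℝ} (hg : Measurable g) (n : ℕ) :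
    Measurable (maxPartialSum g n) := by
  induction n with
  | zero => exact measurable_const
  | succ n ih =>
    refine measurable_const.max ((hg.comp (measurable_pi_apply 0)).add (ih.comp ?_))
    exact measurable_pi_lambda _ fun j => measurable_pi_apply _

/-- Maximal ergodic inequality: if on the invariant event `A` some partial sum of `g (X i)` is
positive, then `g (X 0)` has nonnegative integral over `A`. -/
theorem setIntegral_nonneg_of_exists_sum_pos [IsFiniteMeasure μ] (hX : ∀ i, Measurable (X i))
    (hstat : StrictlyStationary μ X) {A : Set Ω} (hA : MeasurableSet[invariantSigma X] A)
    {g : ℝ → ℝ} (hg : Measurable g) {C : ℝ} (hC : ∀ y, |g y| ≤ C)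
    (hpos : ∀ ω ∈ A, ∃ n, 0 < ∑ i ∈ Finset.range n, g (X i ω)) :
    0 ≤ ∫ ω in A, g (X 0 ω) ∂μ := by
  have hA' : MeasurableSet A := invariantSigma_le hX A hA
  have hC0 : 0 ≤ C := (abs_nonneg _).trans (hC 0)
  let P : Ω → ℕ → ℝ := fun ω j => X j ω
  let P' : Ω → ℕ → ℝ := fun ω j => X (1 + j) ω
  have hP : Measurable P := measurable_pi_lambda _ fun j => hX j
  have hP' : Measurable P' := measurable_pi_lambda _ fun j => hX _
  have hMm : ∀ n, Measurable (maxPartialSum g n) := fun n => measurable_maxPartialSum hg n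
  have hint : ∀ n (Z : Ω → ℕ → ℝ), Measurable Z →
      Integrable (fun ω => maxPartialSum g n (Z ω)) μ := fun n Z hZ =>
    Integrable.of_bound ((hMm n).comp hZ).aestronglyMeasurable (n * C)
      (Eventually.of_forall fun ω => by
        rw [Real.norm_eq_abs, abs_of_nonneg (maxPartialSum_nonneg _ _ _)]
        exact maxPartialSum_le hC0 hC n _)
  have hgint : Integrable (fun ω => g (X 0 ω)) μ :=
    Integrable.of_bound (hg.comp (hX 0)).aestronglyMeasurable C
      (Eventually.of_forall fun ω => hC _)
  let E : ℕ → Set Ω := fun n => A ∩ {ω | 0 < maxPartialSum g (n + 1) (P ω)}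
  have hE' : ∀ n, MeasurableSet {ω | 0 < maxPartialSum g (n + 1) (P ω)} := fun n =>
    measurableSet_lt measurable_const ((hMm (n + 1)).comp hP)
  have hEm : ∀ n, MeasurableSet (E n) := fun n => hA'.inter (hE' n)
  have hEmono : Monotone E := fun m n hmn ω hω =>
    ⟨hω.1, lt_of_lt_of_le hω.2 (maxPartialSum_mono g (P ω) (Nat.succ_le_succ hmn))⟩
  have hEU : ⋃ n, E n = A := by
    refine Set.Subset.antisymm (Set.iUnion_subset fun n => Set.inter_subset_left) fun ω hω => ?_
    obtain ⟨n, hn⟩ := hpos ω hω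
    refine Set.mem_iUnion.2 ⟨n, hω, ?_⟩
    exact lt_of_lt_of_le (hn.trans_le (sum_le_maxPartialSum g n (P ω)))
      (maxPartialSum_mono g (P ω) (Nat.le_succ n))
  have hEint : ∀ n, 0 ≤ ∫ ω in E n, g (X 0 ω) ∂μ := by
    intro n
    have h1 : ∫ ω in E n, g (X 0 ω) ∂μ =
        ∫ ω in A, {ω | 0 < maxPartialSum g (n + 1) (P ω)}.indicator (fun ω => g (X 0 ω)) ω ∂μ := by
      rw [setIntegral_indicator (hE' n)]
    -- Garsia's trick: where the maximum of length n + 1 is positive, it equals g(X 0) plus the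
    -- shifted maximum of length n; elsewhere it is 0 and the shifted maximum is nonnegative. By
    -- stationarity the shift then drops out of the integral, leaving a nonnegative increment.
    have h2 : ∫ ω in A, (maxPartialSum g (n + 1) (P ω) - maxPartialSum g n (P' ω)) ∂μ ≤
        ∫ ω in E n, g (X 0 ω) ∂μ := by
      rw [h1]
      refine integral_mono ((hint _ _ hP).sub (hint _ _ hP')).integrableOn
        (hgint.indicator (hE' n)).integrableOn fun ω => ?_
      have hdef : maxPartialSum g (n + 1) (P ω) =
        max 0 (g (X 0 ω) + maxPartialSum g n (P' ω)) := rfl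
      by_cases hω : 0 < maxPartialSum g (n + 1) (P ω)
      · rw [Set.indicator_of_mem (by exact hω)]
        rcases max_choice 0 (g (X 0 ω) + maxPartialSum g n (P' ω)) with h | h
        · rw [hdef, h] at hω
          exact absurd hω (lt_irrefl _)
        · simp only [hdef, h]
          linarith
      · rw [Set.indicator_of_notMem (by exact hω)]
        have := maxPartialSum_nonneg g n (P' ω)
        simp only
        linarith
    refine le_trans ?_ h2
    rw [integral_sub (hint _ _ hP).integrableOn (hint _ _ hP').integrableOn,
      setIntegral_shift_eq hX hstat hA (hMm n) 1, sub_nonneg]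
    exact integral_mono (hint _ _ hP).integrableOn (hint _ _ hP).integrableOn fun ω =>
      maxPartialSum_mono g (P ω) (Nat.le_succ n)
  have hlim := tendsto_setIntegral_of_monotone (f := fun ω => g (X 0 ω)) (μ := μ) hEm hEmono
    hgint.integrableOn
  rw [hEU] at hlim
  exact ge_of_tendsto' hlim hEint

/-- On an invariant event where p < q < r and the averages exceed r infinitely often, the maximal
inequality makes the integral of f at least r times the measure, while conditioning makes it at most
q times the measure. So the event is null, and rationals leave only countably many of them. -/
theorem ae_notMem_limsupExceeds [IsProbabilityMeasure μ] (hX : ∀ i, Measurable (X i))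
    (hstat : StrictlyStationary μ X) {f : ℝ → ℝ} (hf : Measurable f) {C : ℝ}
    (hC : ∀ y, |f y| ≤ C) :
    ∀ᵐ ω ∂μ, ∀ r : ℚ, (μ[fun ω => f (X 0 ω)|invariantSigma X]) ω < r →
      (fun j => X j ω) ∉ limsupExceeds f r := by
  have hG := invariantSigma_le hX
  have hfint : Integrable (fun ω => f (X 0 ω)) μ :=
    Integrable.of_bound (hf.comp (hX 0)).aestronglyMeasurable C (Eventually.of_forall fun ω => hC _)
  set p := μ[fun ω => f (X 0 ω)|invariantSigma X] with hp
  have hpm : Measurable[invariantSigma X] p := stronglyMeasurable_condExp.measurable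
  -- compare `p` with `q` and the averages with `r`, where `q < r` are rational
  have key : ∀ q r : ℚ, q < r →
      ∀ᵐ ω ∂μ, ¬ (p ω < q ∧ (fun j => X j ω) ∈ limsupExceeds f r) := by
    intro q r hqr
    set A : Set Ω := {ω | p ω < q} ∩ {ω | (fun j => X j ω) ∈ limsupExceeds f r}
    have hA : MeasurableSet[invariantSigma X] A :=
      MeasurableSet.inter (hpm measurableSet_Iio)
        (measurableSet_invariantSigma_limsupExceeds hf hC r)
    have hA' := hG A hA
    have h0 : 0 ≤ ∫ ω in A, (f (X 0 ω) - r) ∂μ := by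
      refine setIntegral_nonneg_of_exists_sum_pos (g := fun y => f y - r) hX hstat hA
        (hf.sub_const _) (C := C + |(r : ℝ)|) (fun y => (abs_sub _ _).trans ?_) ?_
      · exact add_le_add (hC y) le_rfl
      · rintro ω ⟨-, s, hs, hfr⟩
        obtain ⟨n, hn⟩ := hfr.exists
        refine ⟨n, ?_⟩
        rw [Finset.sum_sub_distrib, Finset.sum_const, Finset.card_range, nsmul_eq_mul]
        have : (r : ℝ) * n ≤ s * n := mul_le_mul_of_nonneg_right hs.le (Nat.cast_nonneg n)
        linarith
    have h1 : ∫ ω in A, p ω ∂μ ≤ ∫ ω in A, (q : ℝ) ∂μ :=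
      setIntegral_mono_on integrable_condExp.integrableOn (integrable_const _).integrableOn hA'
        fun ω hω => hω.1.le
    rw [integral_sub hfint.integrableOn (integrable_const _).integrableOn,
      ← setIntegral_condExp hG hfint hA, ← hp] at h0
    simp only [setIntegral_const, smul_eq_mul] at h0 h1
    have hqr' : (q : ℝ) < r := by exact_mod_cast hqr
    have h2 : μ.real A = 0 := by
      have := measureReal_nonneg (μ := μ) (s := A)
      nlinarith
    rw [measureReal_eq_zero_iff] at h2
    exact measure_eq_zero_iff_ae_notMem.1 h2
  filter_upwards [ae_all_iff.2 fun q => ae_all_iff.2 fun r =>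
    eventually_imp_distrib_left.2 (key q r)] with ω hω r hr hmem
  obtain ⟨q, hq1, hq2⟩ := exists_rat_btwn hr
  exact hω q r (by exact_mod_cast hq2) ⟨hq1, hmem⟩

/-- Birkhoff's pointwise ergodic theorem for a bounded function of one coordinate of a strictly
stationary sequence. -/
theorem ae_tendsto_average [IsProbabilityMeasure μ] (hX : ∀ i, Measurable (X i))
    (hstat : StrictlyStationary μ X) {f : ℝ → ℝ} (hf : Measurable f) {C : ℝ}
    (hC : ∀ y, |f y| ≤ C) :
    ∀ᵐ ω ∂μ, Tendsto (fun n : ℕ => (∑ i ∈ Finset.range n, f (X i ω)) / n) atTop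
      (𝓝 ((μ[fun ω => f (X 0 ω)|invariantSigma X]) ω)) := by
  have hneg : μ[fun ω => -f (X 0 ω)|invariantSigma X] =ᵐ[μ]
      -μ[fun ω => f (X 0 ω)|invariantSigma X] := condExp_neg (fun ω => f (X 0 ω)) _
  filter_upwards [ae_notMem_limsupExceeds hX hstat hf hC,
    ae_notMem_limsupExceeds hX hstat hf.neg (C := C) (fun y => by simpa using hC y), hneg]
    with ω h1 h2 h3
  have upper : ∀ (g : ℝ → ℝ) (r s : ℚ), r < s → (fun j => X j ω) ∉ limsupExceeds g r →
      ∀ᶠ n : ℕ in atTop, (∑ i ∈ Finset.range n, g (X i ω)) / n ≤ s := by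
    intro g r s hrs hnot
    have : ¬ ∃ᶠ n : ℕ in atTop, (s : ℝ) * n < ∑ i ∈ Finset.range n, g (X i ω) := fun h =>
      hnot ⟨s, by exact_mod_cast hrs, h⟩
    rw [not_frequently] at this
    filter_upwards [this, eventually_gt_atTop 0] with n hn hn0
    rw [div_le_iff₀ (by exact_mod_cast hn0)]
    exact not_lt.1 hn
  refine tendsto_order.2 ⟨fun b hb => ?_, fun b hb => ?_⟩
  -- The lower bound for f is the upper bound for -f.
  · obtain ⟨r, hr1, hr2⟩ := exists_rat_btwn (neg_lt_neg hb)
    obtain ⟨s, hs1, hs2⟩ := exists_rat_btwn hr2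
    have h4 := h2 r (by
      simp only [Pi.neg_apply] at h3 ⊢
      rw [h3]
      exact hr1)
    filter_upwards [upper _ r s (by exact_mod_cast hs1) h4] with n hn
    simp only [Pi.neg_apply, Finset.sum_neg_distrib, neg_div] at hn
    linarith
  · obtain ⟨r, hr1, hr2⟩ := exists_rat_btwn hb
    obtain ⟨s, hs1, hs2⟩ := exists_rat_btwn hr2
    filter_upwards [upper _ r s (by exact_mod_cast hs1) (h1 r hr1)] with n hn
    exact hn.trans_lt hs2

end Ergodic

/-! ### Order statistics and near-maximum counts of a fixed sequence -/

section Deterministic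

/-- The number of those among the first `n` terms of `x` that are at most `y`. -/
noncomputable def countLE (x : ℕ → ℝ) (y : ℝ) (n : ℕ) : ℝ :=
  ∑ i ∈ Finset.range n, (Set.Iic y).indicator 1 (x i)

theorem orderStat_le_iff {x : ℕ → ℝ} {k n : ℕ} (hk : 1 ≤ k) (hkn : k ≤ n) (y : ℝ) :
    orderStat x k n ≤ y ↔ (k : ℝ) ≤ countLE x y n := by
  have hc : countLE x y n = (Finset.univ.filter fun i : Fin n => x i ≤ y).card := by
    rw [countLE, Finset.sum_range, Finset.card_filter]
    push_cast
    refine Finset.sum_congr rfl fun i _ => ?_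
    simp [Set.indicator_apply]
  rw [orderStat, dif_pos ⟨hk, hkn⟩, hc, Nat.cast_le]
  have hmono := Tuple.monotone_sort fun i : Fin n => x i
  -- Sorting permutes the indices, so it preserves the count.
  have hcard : (Finset.univ.filter fun i : Fin n => x i ≤ y).card =
      (Finset.univ.filter fun i : Fin n =>
        ((fun i : Fin n => x i) ∘ Tuple.sort (fun i : Fin n => x i)) i ≤ y).card := by
    refine (Finset.card_equiv (Tuple.sort (fun i : Fin n => x i)) fun i => ?_).symm
    simp
  rw [hcard]
  have := Tuple.lt_card_le_iff_apply_le_of_monotone (a := y) (j := ⟨k - 1, by omega⟩) hmono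
  simp only [Function.comp_apply] at this ⊢
  rw [← this]
  omega

theorem orderStat_le {x : ℕ → ℝ} {k n : ℕ} (hk : 1 ≤ k) (hkn : k ≤ n) {c : ℝ}
    (hx : ∀ i, x i ≤ c) : orderStat x k n ≤ c := by
  rw [orderStat, dif_pos ⟨hk, hkn⟩]
  exact hx _

theorem nearCount_le (x : ℕ → ℝ) {k n : ℕ} {a q : ℝ} (hq : q ≤ orderStat x k n - a) :
    nearCount x k n a ≤ n - countLE x q n := by
  have : (n : ℝ) - countLE x q n =
      ∑ i ∈ Finset.range n, (1 - (Set.Iic q).indicator (1 : ℝ → ℝ) (x i)) := by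
    simp [countLE]
  rw [this]
  refine Finset.sum_le_sum fun i _ => ?_
  simp only [Set.indicator_apply, Set.mem_Ioo, Set.mem_Iic, Pi.one_apply]
  split_ifs with h1 h2
  · linarith [h1.1]
  all_goals norm_num

theorem le_nearCount (x : ℕ → ℝ) {k n : ℕ} {a q r : ℝ} (hr : orderStat x k n - a ≤ r)
    (hq : q < orderStat x k n) :
    countLE x q n - countLE x r n ≤ nearCount x k n a := by
  rw [countLE, countLE, ← Finset.sum_sub_distrib]
  refine Finset.sum_le_sum fun i _ => ?_
  simp only [Set.indicator_apply, Set.mem_Ioo, Set.mem_Iic, Pi.one_apply]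
  by_cases h : orderStat x k n - a < x i ∧ x i < orderStat x k n
  · rw [if_pos h]
    split_ifs <;> norm_num
  · rw [if_neg h]
    split_ifs with h1 h2
    · norm_num
    · exact absurd ⟨by linarith [not_le.1 h2], by linarith⟩ h
    all_goals norm_num

theorem nearCount_nonneg (x : ℕ → ℝ) (k n : ℕ) (a : ℝ) : 0 ≤ nearCount x k n a :=
  Finset.sum_nonneg fun _ _ => Set.indicator_nonneg (fun _ _ => zero_le_one) _

variable {x : ℕ → ℝ} {k : ℕ → ℕ} {F : ℝ → ℝ} {a : ℝ}

/-- The proportion of terms up to q tends to F q < 1, so it eventually falls below k_n/n. -/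
theorem eventually_lt_orderStat (hk : ∀ n, 1 ≤ n → 1 ≤ k n ∧ k n ≤ n)
    (hklim : Tendsto (fun n => (k n : ℝ) / (n : ℝ)) atTop (𝓝 1))
    (hx : ∀ q : ℚ, Tendsto (fun n : ℕ => countLE x q n / n) atTop (𝓝 (F q))) {q : ℚ}
    (hq : F q < 1) : ∀ᶠ n in atTop, (q : ℝ) < orderStat x (k n) n := by
  filter_upwards [(hx q).eventually_lt hklim hq, eventually_ge_atTop 1] with n hn hn1
  obtain ⟨h1, h2⟩ := hk n hn1
  by_contra! hle
  rw [orderStat_le_iff h1 h2] at hle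
  exact absurd hn (not_lt.2 (div_le_div_of_nonneg_right hle (Nat.cast_nonneg n)))

/-- Once the order statistic exceeds r ≥ q + a, the whole window lies above q. -/
theorem eventually_nearCount_div_lt (hk : ∀ n, 1 ≤ n → 1 ≤ k n ∧ k n ≤ n)
    (hklim : Tendsto (fun n => (k n : ℝ) / (n : ℝ)) atTop (𝓝 1))
    (hx : ∀ q : ℚ, Tendsto (fun n : ℕ => countLE x q n / n) atTop (𝓝 (F q))) {q r : ℚ}
    (hr : F r < 1) (hqr : (q : ℝ) + a ≤ r) {b : ℝ} (hb : 1 - F q < b) :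
    ∀ᶠ n : ℕ in atTop, nearCount x (k n) n a / n < b := by
  have h1 : ∀ᶠ n : ℕ in atTop, 1 - countLE x q n / n < b :=
    ((hx q).const_sub 1).eventually_lt_const hb
  filter_upwards [h1, eventually_lt_orderStat hk hklim hx hr, eventually_gt_atTop 0]
    with n h1 h2 hn
  have hn' : (0 : ℝ) < n := by exact_mod_cast hn
  refine lt_of_le_of_lt ?_ h1
  rw [div_le_iff₀ hn', sub_mul, div_mul_cancel₀ _ hn'.ne', one_mul]
  exact nearCount_le x (by linarith)

/-- If the empirical distribution functions of `x` converge to `F < 1`, near maximum terms become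
rare. -/
theorem tendsto_nearCount_div_zero (hk : ∀ n, 1 ≤ n → 1 ≤ k n ∧ k n ≤ n)
    (hklim : Tendsto (fun n => (k n : ℝ) / (n : ℝ)) atTop (𝓝 1))
    (hx : ∀ q : ℚ, Tendsto (fun n : ℕ => countLE x q n / n) atTop (𝓝 (F q)))
    (hF : Tendsto F atTop (𝓝 1)) (hF1 : ∀ q : ℚ, F q < 1) :
    Tendsto (fun n : ℕ => nearCount x (k n) n a / n) atTop (𝓝 0) := by
  refine tendsto_order.2 ⟨fun b hb => Eventually.of_forall fun n => hb.trans_le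
    (div_nonneg (nearCount_nonneg _ _ _ _) (Nat.cast_nonneg n)), fun b hb => ?_⟩
  obtain ⟨M, hM⟩ := eventually_atTop.1 (hF.eventually_const_lt (show 1 - b < 1 by linarith))
  obtain ⟨q, hq⟩ := exists_rat_gt M
  obtain ⟨r, hr⟩ := exists_rat_gt (q + a)
  exact eventually_nearCount_div_lt hk hklim hx (hF1 r) hr.le (by linarith [hM q hq.le])

/-- The order statistic stays at most c and eventually passes each rational below c. Convergence is
known only at rationals, so continuity of F at c and c - a is what transfers the bounds to the
endpoints. -/
theorem tendsto_nearCount_div (hk : ∀ n, 1 ≤ n → 1 ≤ k n ∧ k n ≤ n)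
    (hklim : Tendsto (fun n => (k n : ℝ) / (n : ℝ)) atTop (𝓝 1))
    (hx : ∀ q : ℚ, Tendsto (fun n : ℕ => countLE x q n / n) atTop (𝓝 (F q))) {c : ℝ}
    (hxc : ∀ i, x i ≤ c) (hF1 : ∀ q : ℚ, (q : ℝ) < c → F q < 1) (hFc : F c = 1)
    (hc : ContinuousAt F c) (hca : ContinuousAt F (c - a)) :
    Tendsto (fun n : ℕ => nearCount x (k n) n a / n) atTop (𝓝 (1 - F (c - a))) := by
  -- rational points on either side of a continuity point with almost the same value of `F`
  have left : ∀ y, ContinuousAt F y → ∀ ε > 0, ∃ q : ℚ, (q : ℝ) < y ∧ F y - ε < F q := by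
    intro y hy ε hε
    obtain ⟨l, hl, h⟩ := exists_Ioc_subset_of_mem_nhds
      (hy.eventually_const_lt (show F y - ε < F y by linarith)) ⟨y - 1, by linarith⟩
    obtain ⟨q, h1, h2⟩ := exists_rat_btwn hl
    exact ⟨q, h2, h ⟨h1, h2.le⟩⟩
  have right : ∀ y, ContinuousAt F y → ∀ ε > 0, ∃ q : ℚ, y < (q : ℝ) ∧ F q < F y + ε := by
    intro y hy ε hε
    obtain ⟨u, hu, h⟩ := exists_Ico_subset_of_mem_nhds
      (hy.eventually_lt_const (show F y < F y + ε by linarith)) ⟨y + 1, by linarith⟩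
    obtain ⟨q, h1, h2⟩ := exists_rat_btwn hu
    exact ⟨q, h1, h ⟨h1.le, h2⟩⟩
  refine tendsto_order.2 ⟨fun b hb => ?_, fun b hb => ?_⟩
  -- Each of the two endpoints may use half of the gap to b.
  · obtain ⟨q, hq, hFq⟩ := left c hc ((1 - F (c - a) - b) / 2) (by linarith)
    obtain ⟨r, hr, hFr⟩ := right (c - a) hca ((1 - F (c - a) - b) / 2) (by linarith)
    have h1 : ∀ᶠ n : ℕ in atTop, b < countLE x q n / n - countLE x r n / n :=
      ((hx q).sub (hx r)).eventually_const_lt (by linarith)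
    filter_upwards [h1, eventually_lt_orderStat hk hklim hx (hF1 q hq), eventually_ge_atTop 1]
      with n h1 h2 hn
    refine h1.trans_le ?_
    rw [← sub_div]
    refine div_le_div_of_nonneg_right (le_nearCount x ?_ h2) (Nat.cast_nonneg n)
    have := orderStat_le (hk n hn).1 (hk n hn).2 hxc
    linarith
  · obtain ⟨q, hq, hFq⟩ := left (c - a) hca (b - (1 - F (c - a))) (by linarith)
    obtain ⟨r, hr1, hr2⟩ := exists_rat_btwn (show (q : ℝ) + a < c by linarith)
    exact eventually_nearCount_div_lt hk hklim hx (hF1 r hr2) hr1.le (by linarith)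

end Deterministic

/-! ### Regular conditional laws -/

section CondLaw

/-- A regular conditional law of `Y` given `comap Z`, evaluated on relations between `Y` and a
function of `Z`. -/
theorem condExp_ae_eq_condDistrib_real {Ω β : Type*} [m0 : MeasurableSpace Ω]
    [mβ : MeasurableSpace β] (μ : Measure Ω) [IsProbabilityMeasure μ] {Z : Ω → β}
    (hZ : Measurable Z) {Y : Ω → ℝ} (hY : Measurable Y) {Q : β → EReal} (hQ : Measurable Q)
    {R : Set (EReal × EReal)} (hR : MeasurableSet R) :
    μ⟦{ω | ((Y ω : EReal), Q (Z ω)) ∈ R}|mβ.comap Z⟧ =ᵐ[μ]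
      fun ω => (condDistrib Y Z μ (Z ω)).real {y | ((y : EReal), Q (Z ω)) ∈ R} := by
  let s : Set (β × ℝ) := {p | ((p.2 : EReal), Q p.1) ∈ R}
  have hs : MeasurableSet s :=
    (measurable_snd.coe_real_ereal.prodMk (hQ.comp measurable_fst)) hR
  have h := condExp_prod_ae_eq_integral_condDistrib (μ := μ) hZ hY.aemeasurable
    (f := s.indicator fun _ => (1 : ℝ)) (stronglyMeasurable_const.indicator hs)
    (Integrable.of_bound ((measurable_const.indicator hs).comp (hZ.prodMk hY)).aestronglyMeasurable
      1 (Eventually.of_forall fun ω => by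
        by_cases hω : (Z ω, Y ω) ∈ s <;> simp [hω]))
  refine h.trans (Eventually.of_forall fun ω => ?_)
  have : (fun y => s.indicator (fun _ => (1 : ℝ)) (Z ω, y)) =
      (Prod.mk (Z ω) ⁻¹' s).indicator 1 := rfl
  simp only [this]
  rw [integral_indicator_one (measurable_prodMk_left hs)]
  rfl

/-- A conditional law of `Y` given `G`. -/
theorem exists_condLaw {Ω : Type*} {G : MeasurableSpace Ω} [m0 : MeasurableSpace Ω] (μ : Measure Ω)
    [IsProbabilityMeasure μ] (hG : G ≤ m0) {Y : Ω → ℝ} (hY : Measurable Y) :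
    ∃ κ : Ω → Measure ℝ, (∀ ω, IsProbabilityMeasure (κ ω)) ∧
      ∀ Q : Ω → EReal, Measurable[G] Q → ∀ R : Set (EReal × EReal), MeasurableSet R →
        μ⟦{ω | ((Y ω : EReal), Q ω) ∈ R}|G⟧ =ᵐ[μ]
          fun ω => (κ ω).real {y | ((y : EReal), Q ω) ∈ R} := by
  have hid : @Measurable Ω Ω m0 G id := fun s hs => hG s hs
  have hcomap : MeasurableSpace.comap id G = G := MeasurableSpace.comap_id
  -- Conditioning on the identity map into Ω equipped with G. Only the target ℝ has to be standard
  -- Borel, so Ω stays arbitrary.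
  refine ⟨fun ω => @condDistrib Ω Ω ℝ _ _ _ m0 G Y id μ _ ω, fun ω => ?_, fun Q hQ R hR => ?_⟩
  · infer_instance
  · have := @condExp_ae_eq_condDistrib_real Ω Ω m0 G μ _ id hid Y hY Q hQ R hR
    rw [hcomap] at this
    exact this

end CondLaw

/-! ### From the conditional law to the pathwise limit -/

section Cdf

theorem continuousAt_cdf {κ : Measure ℝ} [IsProbabilityMeasure κ] {c : ℝ} (hc : κ.real {c} = 0) :
    ContinuousAt (cdf κ) c := by
  have h := (cdf κ).measure_singleton c
  rw [measure_cdf, (measureReal_eq_zero_iff).1 hc] at h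
  have h1 : cdf κ c ≤ Function.leftLim (cdf κ) c := by
    have := ENNReal.ofReal_eq_zero.1 h.symm
    linarith
  rw [(monotone_cdf κ).continuousAt_iff_leftLim_eq_rightLim, StieltjesFunction.rightLim_eq]
  exact le_antisymm ((monotone_cdf κ).leftLim_le le_rfl) h1

/-- The almost sure limit of the proportion of near maximum terms, for a fixed sequence whose
empirical distribution functions converge to that of `κ`, a law with right endpoint `c`. -/
theorem tendsto_nearCount_div_of_cdf {x : ℕ → ℝ} {k : ℕ → ℕ} {a : ℝ}
    (hk : ∀ n, 1 ≤ n → 1 ≤ k n ∧ k n ≤ n)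
    (hklim : Tendsto (fun n => (k n : ℝ) / (n : ℝ)) atTop (𝓝 1))
    {κ : Measure ℝ} [IsProbabilityMeasure κ]
    (hx : ∀ q : ℚ, Tendsto (fun n : ℕ => countLE x q n / n) atTop (𝓝 (κ.real (Set.Iic q))))
    {c : EReal} (hxc : ∀ i, (x i : EReal) ≤ c)
    (hlt : ∀ q : ℚ, ((q : ℝ) : EReal) < c → κ.real (Set.Iic q) < 1)
    (h1 : κ.real {y | (y : EReal) ≤ c} = 1) (h0 : κ.real {y | (y : EReal) = c} = 0)
    (ha : κ.real {y | (y : EReal) = c - (a : EReal)} = 0) :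
    Tendsto (fun n : ℕ => nearCount x (k n) n a / n) atTop
      (𝓝 (({c' : EReal | c' < ⊤}.indicator (fun _ => (1 : ℝ)) c) *
        κ.real {y | c - (a : EReal) < (y : EReal)})) := by
  simp only [← cdf_eq_real] at hx hlt
  induction c with
  | bot => exact absurd (hxc 0) (by simp)
  | top =>
    simp only [Set.mem_ofPred_eq, lt_irrefl, not_false_eq_true, Set.indicator_of_notMem, zero_mul]
    exact tendsto_nearCount_div_zero hk hklim hx (tendsto_cdf_atTop κ) fun q =>
      hlt q (EReal.coe_lt_top _)
  | coe c =>
    simp only [← EReal.coe_sub, EReal.coe_le_coe_iff, EReal.coe_lt_coe_iff, EReal.coe_eq_coe_iff]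
      at hxc hlt h1 h0 ha ⊢
    rw [Set.indicator_of_mem (by exact EReal.coe_lt_top c), one_mul]
    have h2 : κ.real {y | c - a < y} = 1 - cdf κ (c - a) := by
      rw [cdf_eq_real, ← probReal_compl_eq_one_sub measurableSet_Iic, Set.compl_Iic]
      rfl
    rw [h2]
    exact tendsto_nearCount_div hk hklim hx hxc hlt (by rw [cdf_eq_real]; exact h1)
      (continuousAt_cdf h0) (continuousAt_cdf ha)

end Cdf

theorem condExp_indicator_null {Ω : Type*} {G : MeasurableSpace Ω} [m0 : MeasurableSpace Ω]
    {μ : Measure Ω} {s : Set Ω} (hs : μ s = 0) :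
    μ⟦s|G⟧ =ᵐ[μ] fun _ => 0 := by
  have h : (s.indicator fun _ => (1 : ℝ)) =ᵐ[μ] (0 : Ω → ℝ) := indicator_meas_zero hs
  have := condExp_congr_ae (m := G) h
  rwa [condExp_zero] at this

theorem ae_mem_of_condExp_eq_one {Ω : Type*} {G : MeasurableSpace Ω} [m0 : MeasurableSpace Ω]
    {μ : Measure Ω} [IsProbabilityMeasure μ] (hG : G ≤ m0) {s : Set Ω} (hs : MeasurableSet s)
    (h : μ⟦s|G⟧ =ᵐ[μ] fun _ => 1) : ∀ᵐ ω ∂μ, ω ∈ s := by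
  have hint : Integrable (s.indicator fun _ => (1 : ℝ)) μ := (integrable_const 1).indicator hs
  have h1 := integral_condExp (μ := μ) (f := s.indicator fun _ => (1 : ℝ)) hG
  rw [integral_congr_ae h, integral_indicator_const _ hs] at h1
  simp only [integral_const, probReal_univ, smul_eq_mul, mul_one] at h1
  have h2 : μ s = 1 := by
    rw [← ENNReal.toReal_eq_one_iff]
    exact h1.symm
  exact (prob_compl_eq_zero_iff hs).2 h2

/-! ### Almost sure limit along deterministic sample sizes -/

section Sequence

variable {Ω : Type*} [m0 : MeasurableSpace Ω] {μ : Measure Ω} {X : ℕ → Ω → ℝ}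

/-- If an invariant variable dominates the first term, it dominates all terms. -/
theorem ae_forall_le [IsProbabilityMeasure μ] (hX : ∀ i, Measurable (X i))
    (hstat : StrictlyStationary μ X) {Q : Ω → EReal} (hQ : Measurable[invariantSigma X] Q)
    (h0 : ∀ᵐ ω ∂μ, (X 0 ω : EReal) ≤ Q ω) : ∀ᵐ ω ∂μ, ∀ i, (X i ω : EReal) ≤ Q ω := by
  -- The event Q < q is invariant, so stationarity carries the null probability of Q < q < X 0 over
  -- to X i.
  have key : ∀ (i : ℕ) (q : ℚ), ∀ᵐ ω ∂μ, Q ω < ((q : ℝ) : EReal) → X i ω ≤ q := by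
    intro i q
    have hA : MeasurableSet[invariantSigma X] {ω | Q ω < ((q : ℝ) : EReal)} :=
      hQ measurableSet_Iio
    have hA' := invariantSigma_le hX _ hA
    have hF : Measurable ({x : ℕ → ℝ | (q : ℝ) < x 0}.indicator fun _ => (1 : ℝ)) :=
      measurable_const.indicator (measurableSet_lt measurable_const (measurable_pi_apply 0))
    have h := setIntegral_shift_eq hX hstat hA hF i
    have hm : ∀ j, MeasurableSet {ω | (q : ℝ) < X j ω} := fun j =>
      measurableSet_lt measurable_const (hX j)
    have hr : ∀ j, (fun ω => ({x : ℕ → ℝ | (q : ℝ) < x 0}.indicator fun _ => (1 : ℝ))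
        (fun l => X (j + l) ω)) = {ω | (q : ℝ) < X j ω}.indicator fun _ => (1 : ℝ) := fun j => rfl
    have hr0 := hr 0
    simp only [zero_add] at hr0
    rw [hr, hr0, setIntegral_indicator (hm i), setIntegral_indicator (hm 0)] at h
    simp only [setIntegral_const, smul_eq_mul, mul_one] at h
    have hz : μ.real ({ω | Q ω < ((q : ℝ) : EReal)} ∩ {ω | (q : ℝ) < X 0 ω}) = 0 := by
      rw [measureReal_eq_zero_iff]
      refine measure_eq_zero_iff_ae_notMem.2 ?_
      filter_upwards [h0] with ω hω hmem
      have h1 : (X 0 ω : EReal) < ((q : ℝ) : EReal) := hω.trans_lt hmem.1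
      exact absurd (EReal.coe_lt_coe_iff.1 h1) (not_lt.2 hmem.2.le)
    rw [hz, measureReal_eq_zero_iff] at h
    filter_upwards [measure_eq_zero_iff_ae_notMem.1 h] with ω hω hq
    by_contra! hlt
    exact hω ⟨hq, hlt⟩
  filter_upwards [ae_all_iff.2 fun i => ae_all_iff.2 (key i)] with ω hω i
  refine le_of_forall_gt_imp_ge_of_dense fun c hc => ?_
  obtain ⟨q, hq1, hq2⟩ := EReal.lt_iff_exists_rat_btwn.1 hc
  exact (EReal.coe_le_coe_iff.2 (hω i q hq1)).trans hq2.le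

/-- Almost surely, the proportion of near maximum terms converges along the deterministic sample
sizes. -/
theorem ae_tendsto_nearCount_div [IsProbabilityMeasure μ] (hX : ∀ i, Measurable (X i))
    (hstat : StrictlyStationary μ X) {k : ℕ → ℕ} (hk : ∀ n, 1 ≤ n → 1 ≤ k n ∧ k n ≤ n)
    (hklim : Tendsto (fun n => (k n : ℝ) / (n : ℝ)) atTop (𝓝 1)) {a : ℝ} {γ : Ω → EReal}
    (hγ : IsCondRightEndpoint μ (invariantSigma X) (X 0) γ)
    (hγ0 : μ {ω | (X 0 ω : EReal) = γ ω} = 0)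
    (hγa : μ {ω | (X 0 ω : EReal) = γ ω - (a : EReal)} = 0) :
    ∀ᵐ ω ∂μ, Tendsto (fun n : ℕ => nearCount (fun i => X i ω) (k n) n a / n) atTop
      (𝓝 (limitVariable μ (invariantSigma X) (X 0) γ a ω)) := by
  have hG := invariantSigma_le hX
  obtain ⟨κ, hκp, hκ⟩ := exists_condLaw μ hG (hX 0)
  have hγa_meas : Measurable[invariantSigma X] fun ω => γ ω - (a : EReal) := by
    have : Measurable fun c : EReal => c - (a : EReal) := by
      simp only [sub_eq_add_neg]
      exact (measurable_id.add measurable_const)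
    exact this.comp hγ.measurable
  have hle : MeasurableSet {p : EReal × EReal | p.1 ≤ p.2} :=
    measurableSet_le measurable_fst measurable_snd
  have heq : MeasurableSet {p : EReal × EReal | p.1 = p.2} :=
    measurableSet_eq_fun measurable_fst measurable_snd
  have hgt : MeasurableSet {p : EReal × EReal | p.2 < p.1} :=
    measurableSet_lt measurable_snd measurable_fst
  have hκle : ∀ Q : Ω → EReal, Measurable[invariantSigma X] Q →
      μ⟦{ω | (X 0 ω : EReal) ≤ Q ω}|invariantSigma X⟧ =ᵐ[μ]
        fun ω => (κ ω).real {y | (y : EReal) ≤ Q ω} := fun Q hQ => hκ Q hQ _ hle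
  have hκq : ∀ q : ℚ, μ[fun ω => (Set.Iic (q : ℝ)).indicator 1 (X 0 ω)|invariantSigma X] =ᵐ[μ]
      fun ω => (κ ω).real (Set.Iic q) := by
    intro q
    have := hκle (fun _ => ((q : ℝ) : EReal)) measurable_const
    simp only [EReal.coe_le_coe_iff] at this
    exact this
  have hbirk : ∀ q : ℚ, ∀ᵐ ω ∂μ, Tendsto (fun n : ℕ => countLE (fun i => X i ω) q n / n) atTop
      (𝓝 ((κ ω).real (Set.Iic q))) := by
    intro q
    have h := ae_tendsto_average (μ := μ) hX hstat (f := (Set.Iic (q : ℝ)).indicator 1)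
      (measurable_one.indicator measurableSet_Iic) (C := 1) (fun y => by
        simp only [Set.indicator_apply]
        split_ifs <;> norm_num)
    filter_upwards [h, hκq q] with ω h1 h2
    rw [h2] at h1
    exact h1
  have hdom : ∀ᵐ ω ∂μ, (X 0 ω : EReal) ≤ γ ω :=
    ae_mem_of_condExp_eq_one hG (measurableSet_le (hX 0).coe_real_ereal
      (hγ.measurable.mono hG le_rfl)) hγ.condProb_le
  have hγle : ∀ᵐ ω ∂μ, (κ ω).real {y | (y : EReal) ≤ γ ω} = 1 :=
    (hκle γ hγ.measurable).symm.trans hγ.condProb_le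
  -- lowering `γ` to `q` where `q < γ` and `X 0 ≤ q` is conditionally almost sure
  have hmin : ∀ q : ℚ, ∀ᵐ ω ∂μ, ((q : ℝ) : EReal) < γ ω → (κ ω).real (Set.Iic q) < 1 := by
    intro q
    set p : Ω → ℝ := μ[fun ω => (Set.Iic (q : ℝ)).indicator 1 (X 0 ω)|invariantSigma X]
    have hA : MeasurableSet[invariantSigma X] {ω | p ω = 1} :=
      (stronglyMeasurable_condExp.measurable : Measurable[invariantSigma X] p)
        (measurableSet_singleton 1)
    classical
    let Q : Ω → EReal := fun ω => if p ω = 1 then ((q : ℝ) : EReal) else γ ω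
    have hQ : Measurable[invariantSigma X] Q := Measurable.ite hA measurable_const hγ.measurable
    have hQ1 : μ⟦{ω | (X 0 ω : EReal) ≤ Q ω}|invariantSigma X⟧ =ᵐ[μ] fun _ => 1 := by
      filter_upwards [hκle Q hQ, hγle, hκq q] with ω h1 h2 h3
      rw [h1]
      by_cases hpω : p ω = 1
      · simp only [Q, if_pos hpω, EReal.coe_le_coe_iff]
        exact h3.symm.trans hpω
      · simp only [Q, if_neg hpω]
        exact h2
    filter_upwards [hγ.minimal Q hQ hQ1, hκq q] with ω h1 h2 hqω
    have := hκp ω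
    refine lt_of_le_of_ne measureReal_le_one fun h => ?_
    have hpω : p ω = 1 := h2.trans h
    simp only [Q, if_pos hpω] at h1
    exact absurd hqω (not_lt.2 h1)
  filter_upwards [ae_all_iff.2 hbirk, ae_forall_le hX hstat hγ.measurable hdom, ae_all_iff.2 hmin,
    hγle, (hκ γ hγ.measurable _ heq).symm.trans (condExp_indicator_null hγ0),
    (hκ _ hγa_meas _ heq).symm.trans (condExp_indicator_null hγa), hκ _ hγa_meas _ hgt]
    with ω h1 h2 h3 h4 h5 h6 h7
  have := hκp ω
  have := tendsto_nearCount_div_of_cdf hk hklim h1 h2 h3 h4 h5 h6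
  rw [limitVariable]
  rw [h7]
  exact this

end Sequence

theorem measurable_limitVariable {Ω : Type*} {G : MeasurableSpace Ω} [m0 : MeasurableSpace Ω]
    {μ : Measure Ω} (hG : G ≤ m0) {Y : Ω → ℝ} {γ : Ω → EReal} (hγ : Measurable[G] γ) (a : ℝ) :
    Measurable (limitVariable μ G Y γ a) :=
  (measurable_const.indicator (hG _ (hγ measurableSet_Iio))).mul
    (stronglyMeasurable_condExp.measurable.mono hG le_rfl)

/-! ### Random sample sizes -/

section RandomIndex

variable {Ω : Type*} [m0 : MeasurableSpace Ω] {μ : Measure Ω}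

/-- Almost sure convergence of a sequence gives convergence in measure along random indices that
tend to infinity in probability. -/
theorem tendstoInMeasure_comp_randomIndex [IsFiniteMeasure μ] {Y : ℕ → Ω → ℝ}
    {L : Ω → ℝ} (hY : ∀ n, Measurable (Y n)) (hL : Measurable L)
    (h : ∀ᵐ ω ∂μ, Tendsto (fun n => Y n ω) atTop (𝓝 (L ω))) {N : ℝ≥0 → Ω → ℕ}
    (hN : TendstoInftyInProbability μ N) :
    TendstoInMeasure μ (fun t ω => Y (N t ω) ω) atTop L := by
  rw [tendstoInMeasure_iff_dist]
  intro ε hε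
  -- The event of a deviation at some index from D on. It contains any deviation at N(t) > D,
  -- however N(t) depends on Y.
  let E : ℕ → Set Ω := fun D => ⋃ n : ℕ, ⋃ _ : D ≤ n, {ω | ε ≤ dist (Y n ω) (L ω)}
  have hEm : ∀ D, MeasurableSet (E D) := fun D => MeasurableSet.iUnion fun n =>
    MeasurableSet.iUnion fun _ => measurableSet_le measurable_const ((hY n).dist hL)
  have hEanti : Antitone E := fun D D' hD => Set.iUnion_mono fun n =>
    Set.iUnion_subset fun hn => Set.subset_iUnion_of_subset (hD.trans hn) subset_rfl
  have hEnull : μ (⋂ D, E D) = 0 := by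
    refine measure_eq_zero_iff_ae_notMem.2 ?_
    filter_upwards [h] with ω hω hmem
    obtain ⟨D, hD⟩ := eventually_atTop.1 (Metric.tendsto_nhds.1 hω ε hε)
    have := Set.mem_iInter.1 hmem D
    simp only [E, Set.mem_iUnion] at this
    obtain ⟨n, hn, hn'⟩ := this
    exact absurd (hD n hn) (not_lt.2 hn')
  have hElim := tendsto_measure_iInter_atTop (μ := μ) (fun D => (hEm D).nullMeasurableSet) hEanti
    ⟨0, measure_ne_top _ _⟩
  rw [hEnull] at hElim
  rw [ENNReal.tendsto_nhds_zero] at hElim ⊢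
  intro δ hδ
  have hδ2 : 0 < δ / 2 := ENNReal.half_pos hδ.ne'
  obtain ⟨D, hD⟩ := (hElim (δ / 2) hδ2).exists
  filter_upwards [ENNReal.tendsto_nhds_zero.1 (hN D) (δ / 2) hδ2] with t ht
  calc μ {ω | ε ≤ dist (Y (N t ω) ω) (L ω)} ≤ μ (E D ∪ {ω | (N t ω : ℝ) ≤ D}) := by
        refine measure_mono fun ω hω => ?_
        by_cases hND : (N t ω : ℝ) ≤ D
        · exact Or.inr hND
        · refine Or.inl (Set.mem_iUnion.2 ⟨N t ω, Set.mem_iUnion.2 ⟨?_, hω⟩⟩)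
          exact_mod_cast (not_le.1 hND).le
    _ ≤ μ (E D) + μ {ω | (N t ω : ℝ) ≤ D} := measure_union_le _ _
    _ ≤ δ / 2 + δ / 2 := add_le_add hD ht
    _ = δ := ENNReal.add_halves δ

variable {X : ℕ → Ω → ℝ}

/-- Through the counting duality, no measurability of the sorting permutation is needed. -/
theorem measurable_orderStat (hX : ∀ i, Measurable (X i)) (k n : ℕ) :
    Measurable fun ω => orderStat (fun i => X i ω) k n := by
  by_cases h : 1 ≤ k ∧ k ≤ n
  · refine measurable_of_Iic fun y => ?_
    have : (fun ω => orderStat (fun i => X i ω) k n) ⁻¹' Set.Iic y =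
        {ω | (k : ℝ) ≤ countLE (fun i => X i ω) y n} := by
      ext ω
      exact orderStat_le_iff h.1 h.2 y
    rw [this]
    refine measurableSet_le measurable_const (Finset.measurable_sum _ fun i _ => ?_)
    exact (measurable_one.indicator measurableSet_Iic).comp (hX i)
  · simp only [orderStat, dif_neg h]
    exact measurable_const

theorem measurable_nearCount (hX : ∀ i, Measurable (X i)) (k n : ℕ) (a : ℝ) :
    Measurable fun ω => nearCount (fun i => X i ω) k n a := by
  refine Finset.measurable_sum _ fun i _ => ?_
  have h := measurable_orderStat hX k n
  exact (measurable_const (a := (1 : ℝ))).indicator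
    ((measurableSet_lt (h.sub_const a) (hX i)).inter (measurableSet_lt (hX i) h))

end RandomIndex

end NearMax

theorem theorem4p1 {Ω : Type*} [MeasurableSpace Ω] (μ : Measure Ω) [IsProbabilityMeasure μ]
    (X : ℕ → Ω → ℝ) (hX : ∀ i, Measurable (X i)) (hstat : NearMax.StrictlyStationary μ X)
    (k : ℕ → ℕ) (hk : ∀ n, 1 ≤ n → 1 ≤ k n ∧ k n ≤ n)
    (hklim : Tendsto (fun n => (k n : ℝ) / (n : ℝ)) atTop (𝓝 1))
    (a : ℝ) (ha : 0 < a)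
    (γ : Ω → EReal)
    (hγ : NearMax.IsCondRightEndpoint μ (NearMax.invariantSigma X) (X 0) γ)
    (hγ0 : μ {ω | (X 0 ω : EReal) = γ ω} = 0)
    (hγa : μ {ω | (X 0 ω : EReal) = γ ω - (a : EReal)} = 0)
    (N : ℝ≥0 → Ω → ℕ) (hN : ∀ t, Measurable (N t)) :
    ((∀ᵐ ω ∂μ, Tendsto (fun t => N t ω) atTop atTop) →
      ∀ᵐ ω ∂μ, Tendsto (fun t => NearMax.randomNearCount X k (N t) a ω / (N t ω : ℝ)) atTop
        (𝓝 (NearMax.limitVariable μ (NearMax.invariantSigma X) (X 0) γ a ω))) ∧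
    (NearMax.TendstoInftyInProbability μ N →
      TendstoInMeasure μ (fun t ω => NearMax.randomNearCount X k (N t) a ω / (N t ω : ℝ)) atTop
        (NearMax.limitVariable μ (NearMax.invariantSigma X) (X 0) γ a)) := by
  have h := NearMax.ae_tendsto_nearCount_div hX hstat hk hklim hγ hγ0 hγa
  refine ⟨fun hNlim => ?_, fun hNlim => ?_⟩
  -- When N(t) = 0, division by zero gives the agreed value 0.
  · filter_upwards [h, hNlim] with ω h1 h2
    exact h1.comp h2
  · exact NearMax.tendstoInMeasure_comp_randomIndex
      (Y := fun n ω => NearMax.nearCount (fun i => X i ω) (k n) n a / (n : ℝ))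
      (fun n => (NearMax.measurable_nearCount hX _ n a).div_const _)
      (NearMax.measurable_limitVariable (NearMax.invariantSigma_le hX) hγ.measurable a) h hNlim
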